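/- Let $W$ be a binary-input memoryless symmetric (BMS) channel: its input alphabet is $\{-,+\}$, its output alphabet $\mathcal Y$ carries a reference measure (counting measure for probability mass functions, Lebesgue measure for densities; write $dy$ for it), the output given input $x$ has density $P_x(y)$, successive uses are independent given the inputs, and there is an involution $\sigma$ of $\mathcal Y$, preserving the reference measure, with $P_+(y)=P_-(\sigma(y))$ for all $y\in\mathcal Y$ (for instance $\sigma(y)=-y$). Let $$Z=\int\sqrt{P_+(y)P_-(y)}\,dy\in[0,1],\qquad \chi=1-\sqrt{1-Z}$$ be its Bhattacharyya parameter and its ruin parameter. Let $Y_1,Y_2,\dots$ be random variables with distribution $P_+$ such that the log-likelihood ratios $\Lambda(i)=\log\frac{P_+(Y_i)}{P_-(Y_i)}\in(-\infty,\infty]$ (defined almost surely) are i.i.d., let $S_n=\sum_{i=1}^n\Lambda(i)$, and let $\psi(0)=\mathbb P[\tau_-<\infty]$ with $\tau_-=\inf\{n\ge 1: S_n<0\}$, $\inf\emptyset=\infty$. Then $$\sum_{n=1}^\infty\frac1n\,\mathbb P[S_n<0]\le\frac12\log\frac1{1-Z}$$ (the right-hand side being $+\infty$ if $Z=1$), and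 $$\psi(0)\le 1-\sqrt{1-Z}=\chi.$$ -/

import Mathlib

open MeasureTheory ProbabilityTheory
open scoped ENNReal NNReal

/-- The input alphabet `{-, +}`. -/
inductive BinaryInput : Type
  | minus
  | plus

/-- A binary-input channel with output alphabet `𝒴`, given by its transition densities
`y ↦ P_x(y)` with respect to a reference measure on `𝒴`: the counting measure for probability mass
functions, Lebesgue measure for probability density functions. The channel is used without memory:
the outputs of successive uses are independent given the inputs, so that the one-letter densities
determine all its extensions. -/
structure BinaryInputChannel (𝒴 : Type*) [MeasurableSpace 𝒴] where
  refMeasure : Measure 𝒴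
  density : BinaryInput → 𝒴 → ℝ≥0
  measurable_density : ∀ x, Measurable (density x)
  lintegral_density : ∀ x, ∫⁻ y, (density x y : ℝ≥0∞) ∂refMeasure = 1

namespace BinaryInputChannel

variable {𝒴 : Type*} [MeasurableSpace 𝒴] (W : BinaryInputChannel 𝒴)

/-- The output distribution `P_x` of the channel when the input is `x`. -/
noncomputable def outputLaw (x : BinaryInput) : Measure 𝒴 :=
  W.refMeasure.withDensity fun y => (W.density x y : ℝ≥0∞)

/-- The (memoryless) channel is symmetric: an involution `σ` of the output alphabet, which is
compatible with the reference measure, exchanges `P_+` and `P_-`. On a symmetric subset of `ℝ` one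
may have `σ y = -y`. -/
def IsBMS : Prop :=
  ∃ σ : 𝒴 → 𝒴, Function.Involutive σ ∧ MeasurePreserving σ W.refMeasure W.refMeasure ∧
    ∀ y, W.density .plus y = W.density .minus (σ y)

/-- The Bhattacharyya parameter `Z = ∫ √(P_+(y) P_-(y)) dy`. -/
noncomputable def bhattacharyya : ℝ :=
  ∫ y, √((W.density .plus y : ℝ) * (W.density .minus y : ℝ)) ∂W.refMeasure

/-- The ruin parameter `χ = 1 - √(1 - Z)`. -/
noncomputable def ruinParameter : ℝ := 1 - √(1 - W.bhattacharyya)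

/-- The log-likelihood ratio `log (P_+(y) / P_-(y))`, with values in `[-∞, ∞]`: it is `+∞` where
`P_+(y) > 0 = P_-(y)` and `-∞` where `P_+(y) = 0`; the latter has probability zero under `P_+`. -/
noncomputable def llr (y : 𝒴) : EReal :=
  ENNReal.log ((W.density .plus y : ℝ≥0∞) / (W.density .minus y : ℝ≥0∞))

theorem integrable_density (x : BinaryInput) :
    Integrable (fun y => (W.density x y : ℝ)) W.refMeasure := by
  refine ⟨(W.measurable_density x).coe_nnreal_real.aestronglyMeasurable, ?_⟩
  rw [hasFiniteIntegral_iff_ofReal (Filter.Eventually.of_forall fun y => NNReal.coe_nonneg _)]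
  simp [W.lintegral_density x]

theorem integral_density (x : BinaryInput) :
    ∫ y, (W.density x y : ℝ) ∂W.refMeasure = 1 := by
  rw [integral_eq_lintegral_of_nonneg_ae
    (Filter.Eventually.of_forall fun y => NNReal.coe_nonneg _)
    (W.integrable_density x).aestronglyMeasurable]
  simp [W.lintegral_density x]

theorem sqrt_mul_le (y : 𝒴) :
    √((W.density .plus y : ℝ) * (W.density .minus y : ℝ)) ≤
      ((W.density .plus y : ℝ) + (W.density .minus y : ℝ)) / 2 := by
  apply Real.sqrt_le_iff.2
  have h1 := NNReal.coe_nonneg (W.density .plus y)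
  have h2 := NNReal.coe_nonneg (W.density .minus y)
  constructor
  · positivity
  · nlinarith [sq_nonneg ((W.density .plus y : ℝ) - (W.density .minus y : ℝ))]

/-- The integral that defines the Bhattacharyya parameter converges. -/
theorem integrable_sqrt_mul :
    Integrable (fun y => √((W.density .plus y : ℝ) * (W.density .minus y : ℝ)))
      W.refMeasure := by
  refine Integrable.mono' (((W.integrable_density .plus).add
    (W.integrable_density .minus)).div_const 2) ?_ ?_
  · exact (((W.measurable_density .plus).coe_nnreal_real.mul
      (W.measurable_density .minus).coe_nnreal_real).sqrt).aestronglyMeasurable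
  · refine Filter.Eventually.of_forall fun y => ?_
    rw [Real.norm_of_nonneg (Real.sqrt_nonneg _)]
    exact W.sqrt_mul_le y

theorem bhattacharyya_nonneg : 0 ≤ W.bhattacharyya :=
  integral_nonneg fun _ => Real.sqrt_nonneg _

theorem bhattacharyya_le_one : W.bhattacharyya ≤ 1 := by
  have h := integral_mono W.integrable_sqrt_mul (((W.integrable_density .plus).add
    (W.integrable_density .minus)).div_const 2) W.sqrt_mul_le
  refine h.trans (le_of_eq ?_)
  simp only [Pi.add_apply]
  rw [integral_div, integral_add (W.integrable_density .plus) (W.integrable_density .minus),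
    W.integral_density, W.integral_density]
  norm_num

end BinaryInputChannel

/-- The random walk `S_n = x + X_1 + ⋯ + X_n` started at `x`; the increments, which may take
infinite values, are numbered from `0`. -/
noncomputable def walk {Ω : Type*} (X : ℕ → Ω → EReal) (x : ℝ) (n : ℕ) (ω : Ω) : EReal :=
  (x : EReal) + ∑ i ∈ Finset.range n, X i ω

/-- The ruin time `τ_- = inf {n ≥ 1 : S_n < 0}` of the walk started at `x`, with `inf ∅ = ∞`. -/
noncomputable def ruinTime {Ω : Type*} (X : ℕ → Ω → EReal) (x : ℝ) (ω : Ω) : ℕ∞ :=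
  sInf ((fun n : ℕ => (n : ℕ∞)) '' {n : ℕ | 1 ≤ n ∧ walk X x n ω < 0})

/-- The ultimate ruin function `ψ(x) = ℙ_x[τ_- < ∞]`. -/
noncomputable def ruinProbability {Ω : Type*} [MeasurableSpace Ω] (P : Measure Ω)
    (X : ℕ → Ω → EReal) (x : ℝ) : ℝ :=
  P.real {ω | ruinTime X x ω < ⊤}

/-! Under `P_+`, the finite log-likelihood ratios have law `Z * exp (x / 2)` times a probability
measure `ν` on `ℝ`. Up to normalisation, `ν` is the law of the ratio under `√(P_+ P_-)`, and the
channel symmetry makes it invariant under negation. On events of `n` finite increments with `S_n ≤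
0`, the product of the exponential factors is at most 1, so their probability is at most `Z ^ n`
times that under the symmetric walk (`measure_le_pow_mul_iidLaw`).

For the first bound, the symmetric walk is negative at time `n` with probability at most 1/2. Hence
`ℙ[S_n < 0] ≤ Z ^ n / 2`, and the logarithmic series sums these bounds.

For the second, let `p n` be the probability that the symmetric walk is non-negative up to time `n`.
Ruin at time `n + 1` has probability at most `Z ^ (n + 1) * (p n - p (n + 1))`, and these bounds sum
to `1 - (1 - Z) * A` with `A = ∑ p n * Z ^ n`. Splitting a path at its first minimum shows that the
convolution square of `p` is at least 1 (`one_le_sum_stayNonneg`). So `A ^ 2 ≥ 1 / (1 - Z)`, and the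
sum is at most `1 - √(1 - Z)`. -/

/-! ### Symmetric random walks: first minimum and generating function. -/

section SymmetricWalk

open Finset

/-- The set of trajectories of increments whose first `n` partial sums are non-negative. -/
def stayNonneg (n : ℕ) : Set (ℕ → ℝ) := {x | ∀ j ≤ n, 0 ≤ ∑ i ∈ range j, x i}

theorem measurableSet_stayNonneg (n : ℕ) : MeasurableSet (stayNonneg n) := by
  simp only [stayNonneg, Set.ofPred_forall]
  exact MeasurableSet.iInter fun j => MeasurableSet.iInter fun _ =>
    measurableSet_le measurable_const (by fun_prop)

theorem stayNonneg_succ_subset (n : ℕ) : stayNonneg (n + 1) ⊆ stayNonneg n :=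
  fun _ hx j hj => hx j (by omega)

theorem stayNonneg_zero : stayNonneg 0 = Set.univ := by
  ext x; simp [stayNonneg]

/-- The set of trajectories whose `k`-th partial sum is strictly below all the earlier ones. -/
def strictMinAt (k : ℕ) : Set (ℕ → ℝ) :=
  {x | ∀ j < k, ∑ i ∈ range k, x i < ∑ i ∈ range j, x i}

theorem measurableSet_strictMinAt (k : ℕ) : MeasurableSet (strictMinAt k) := by
  simp only [strictMinAt, Set.ofPred_forall]
  exact MeasurableSet.iInter fun j => MeasurableSet.iInter fun _ =>
    measurableSet_lt (by fun_prop) (by fun_prop)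

/-- Every finite trajectory has a first minimum. -/
theorem exists_mem_strictMinAt (x : ℕ → ℝ) (n : ℕ) :
    ∃ k ≤ n, x ∈ strictMinAt k ∧ (fun i => x (k + i)) ∈ stayNonneg (n - k) := by
  classical
  have hex : ∃ k, k ≤ n ∧ ∀ j ≤ n, ∑ i ∈ range k, x i ≤ ∑ i ∈ range j, x i := by
    obtain ⟨k, hk, h⟩ := exists_min_image (range (n + 1)) (fun k => ∑ i ∈ range k, x i)
      ⟨0, by simp⟩
    exact ⟨k, by simpa [Nat.lt_succ_iff] using hk, fun j hj => h j (by simp; omega)⟩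
  -- The least minimiser: its minimality makes the inequality against earlier sums strict.
  obtain ⟨hk, hmin⟩ := Nat.find_spec hex
  refine ⟨Nat.find hex, hk, fun j hj => ?_, fun j hj => ?_⟩
  · by_contra! hle
    exact Nat.find_min hex hj ⟨by omega, fun l hl => hle.trans (hmin l hl)⟩
  · have := hmin (Nat.find hex + j) (by omega)
    rw [sum_range_add] at this
    linarith

variable (ν : Measure ℝ) [IsProbabilityMeasure ν]

/-- The law of a sequence of independent increments with law `ν`. -/
noncomputable abbrev iidLaw : Measure (ℕ → ℝ) := Measure.infinitePi fun _ : ℕ => ν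

theorem iidLaw_preimage_comp {f : ℕ → ℕ} (hf : f.Injective) {A : Set (ℕ → ℝ)}
    (hA : MeasurableSet A) : iidLaw ν {x | (fun i => x (f i)) ∈ A} = iidLaw ν A := by
  have h := Measure.map_infinitePi_infinitePi_of_inj (P := fun _ : ℕ => ν) hf
  rw [iidLaw]
  conv_rhs => rw [← h]
  rw [Measure.map_apply (by fun_prop) hA]
  rfl

theorem iidLaw_preimage_neg (hν : ν.map (fun x => -x) = ν) {A : Set (ℕ → ℝ)}
    (hA : MeasurableSet A) : iidLaw ν {x | (fun i => -x i) ∈ A} = iidLaw ν A := by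
  have h := Measure.infinitePi_map_pi (μ := fun _ : ℕ => ν) (f := fun _ x => -x)
    fun _ => measurable_neg
  simp only [hν] at h
  rw [iidLaw]
  conv_rhs => rw [← h]
  rw [Measure.map_apply (by fun_prop) hA]
  rfl

/-- The first event depends only on the coordinates below `k`, the second only on those from `k` on;
the latter is also shift invariant in law. -/
theorem iidLaw_strictMinAt_inter (k l : ℕ) :
    iidLaw ν (strictMinAt k ∩ {x | (fun i => x (k + i)) ∈ stayNonneg l}) =
      iidLaw ν (strictMinAt k) * iidLaw ν (stayNonneg l) := by
  have hind : iIndepFun (fun (i : ℕ) (x : ℕ → ℝ) => x i) (iidLaw ν) :=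
    iIndepFun_infinitePi (X := fun _ x => x) fun _ => measurable_id
  have hdisj : Disjoint {i : ℕ | i < k} {i : ℕ | k ≤ i} := by
    rw [Set.disjoint_left]; intro i hi hi'; simp at hi hi'; omega
  have h := indep_iSup_of_disjoint (fun i => (measurable_pi_apply i).comap_le) hind.iIndep hdisj
  rw [← iidLaw_preimage_comp ν (add_right_injective k) (measurableSet_stayNonneg l)]
  have hmeas : ∀ (T : Set ℕ) (s : Finset ℕ) (f : ℕ → ℕ), (∀ i ∈ s, f i ∈ T) →
      Measurable[⨆ i ∈ T, MeasurableSpace.comap (fun x : ℕ → ℝ => x i) inferInstance]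
        (fun x : ℕ → ℝ => ∑ i ∈ s, x (f i)) := by
    intro T s f hs
    refine @Finset.measurable_fun_sum _ _ _ _ _ _ (_) _ s fun i hi => ?_
    exact Measurable.mono (comap_measurable (fun x : ℕ → ℝ => x (f i)))
      (le_iSup₂_of_le (f i) (hs i hi) le_rfl) le_rfl
  refine (Indep_iff _ _ _).1 h _ _ ?_ ?_
  · simp only [strictMinAt, Set.ofPred_forall]
    refine MeasurableSet.iInter fun j => MeasurableSet.iInter fun hj => ?_
    exact @measurableSet_lt _ _ _ _ _ (_) _ _ _ _ _ (hmeas {i | i < k} (range k) id fun i hi => mem_range.1 hi)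
      (hmeas {i | i < k} (range j) id fun i hi => (mem_range.1 hi).trans hj)
  · have hset : {x : ℕ → ℝ | (fun i => x (k + i)) ∈ stayNonneg l} =
        ⋂ j, ⋂ (_ : j ≤ l), {x | 0 ≤ ∑ i ∈ range j, x (k + i)} := by
      ext x; simp [stayNonneg]
    rw [hset]
    refine MeasurableSet.iInter fun j => MeasurableSet.iInter fun hj => ?_
    exact @measurableSet_le _ _ _ _ _ (_) _ _ _ _ _ (@measurable_const _ _ (_) (_) _)
      (hmeas {i | k ≤ i} (range j) (fun i => k + i) fun i _ => Nat.le_add_right k i)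

/-- Reversing the first `k` increments and changing their signs preserves the law and turns a strict
minimum at `k` into positivity of the sums at times `1, …, k`. -/
theorem iidLaw_strictMinAt_le (hν : ν.map (fun x => -x) = ν) (k : ℕ) :
    iidLaw ν (strictMinAt k) ≤ iidLaw ν (stayNonneg k) := by
  -- Reversal of the first `k` indices, extended by the identity to stay injective on `ℕ`.
  let r : ℕ → ℕ := fun i => if i < k then k - 1 - i else i
  have hr : r.Injective := by
    intro a b hab
    simp only [r] at hab
    split_ifs at hab <;> omega
  rw [← iidLaw_preimage_comp ν hr (measurableSet_stayNonneg k),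
    ← iidLaw_preimage_neg ν hν (measurableSet_strictMinAt k)]
  refine measure_mono fun x hx j hj => ?_
  have hsum : ∑ i ∈ range j, x (r i) = ∑ i ∈ range k, x i - ∑ i ∈ range (k - j), x i := by
    obtain ⟨m, rfl⟩ := Nat.exists_eq_add_of_le' hj
    rw [Nat.add_sub_cancel, sum_range_add, add_sub_cancel_left, ← sum_range_reflect]
    refine sum_congr rfl fun i hi => ?_
    have := mem_range.1 hi
    simp only [r]
    rw [if_pos (by omega)]
    congr 1; omega
  rcases Nat.eq_zero_or_pos j with rfl | hj0
  · simp
  · have := hx (k - j) (by omega)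
    simp only [sum_neg_distrib] at this
    rw [hsum]; linarith

/-- For a symmetric walk, the convolution square of the probabilities of staying non-negative is at
least one. -/
theorem one_le_sum_stayNonneg (hν : ν.map (fun x => -x) = ν) (n : ℕ) :
    1 ≤ ∑ k ∈ range (n + 1),
      (iidLaw ν).real (stayNonneg k) * (iidLaw ν).real (stayNonneg (n - k)) := by
  have h1 : (1 : ℝ≥0∞) ≤ ∑ k ∈ range (n + 1),
      iidLaw ν (stayNonneg k) * iidLaw ν (stayNonneg (n - k)) := by
    calc (1 : ℝ≥0∞) = iidLaw ν Set.univ := measure_univ.symm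
      _ ≤ iidLaw ν (⋃ k ∈ range (n + 1),
          (strictMinAt k ∩ {x | (fun i => x (k + i)) ∈ stayNonneg (n - k)})) := by
        refine measure_mono fun x _ => ?_
        obtain ⟨k, hk, h⟩ := exists_mem_strictMinAt x n
        simp only [Set.mem_iUnion]
        exact ⟨k, by simp; omega, h⟩
      _ ≤ _ := measure_biUnion_finset_le _ _
      _ ≤ _ := by
        refine sum_le_sum fun k _ => ?_
        rw [iidLaw_strictMinAt_inter]
        exact mul_le_mul_left (iidLaw_strictMinAt_le ν hν k) _
  have h2 := ENNReal.toReal_mono (by simp [ENNReal.sum_eq_top, ENNReal.mul_eq_top]) h1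
  rw [ENNReal.toReal_sum (by simp [ENNReal.mul_eq_top])] at h2
  simpa [Measure.real] using h2

/-- The events of a negative and of a positive sum are disjoint and, by symmetry, equally likely. -/
theorem iidLaw_sum_neg_le (hν : ν.map (fun x => -x) = ν) (n : ℕ) :
    iidLaw ν {x | ∑ i ∈ range n, x i < 0} ≤ 2⁻¹ := by
  have hm : MeasurableSet {x : ℕ → ℝ | ∑ i ∈ range n, x i < 0} :=
    measurableSet_lt (by fun_prop) measurable_const
  have h := iidLaw_preimage_neg ν hν hm
  have hd : Disjoint {x : ℕ → ℝ | ∑ i ∈ range n, x i < 0}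
      {x | (fun i => -x i) ∈ {x : ℕ → ℝ | ∑ i ∈ range n, x i < 0}} := by
    rw [Set.disjoint_left]
    intro x hx hx'
    simp only [Set.mem_ofPred_eq, sum_neg_distrib] at hx hx'
    linarith
  have hle : iidLaw ν {x | ∑ i ∈ range n, x i < 0} * 2 ≤ 1 := by
    rw [mul_two]
    nth_rw 2 [← h]
    rw [← measure_union' hd hm]
    exact prob_le_one
  rw [← one_div]
  exact (ENNReal.le_div_iff_mul_le (by simp) (by simp)).2 hle

/-- If `p` is bounded and its convolution square is at least one, then its generating function is
at least `1 / √(1 - s)`; stated for the increments of `p`. -/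
theorem hasSum_pow_mul_sub_le {p : ℕ → ℝ} (h0 : ∀ n, 0 ≤ p n) (h1 : ∀ n, p n ≤ 1)
    (hp0 : p 0 = 1) (hconv : ∀ n, 1 ≤ ∑ k ∈ range (n + 1), p k * p (n - k))
    {s : ℝ} (hs0 : 0 ≤ s) (hs1 : s < 1) :
    ∃ a ≤ 1 - √(1 - s), HasSum (fun n => s ^ (n + 1) * (p n - p (n + 1))) a := by
  have hsum : Summable fun n => p n * s ^ n :=
    Summable.of_nonneg_of_le (fun n => mul_nonneg (h0 n) (pow_nonneg hs0 n))
      (fun n => mul_le_of_le_one_left (pow_nonneg hs0 n) (h1 n))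
      (summable_geometric_of_lt_one hs0 hs1)
  set A := ∑' n, p n * s ^ n with hA
  have hA0 : 0 ≤ A := tsum_nonneg fun n => mul_nonneg (h0 n) (pow_nonneg hs0 n)
  have hn : Summable fun n => ‖p n * s ^ n‖ := hsum.norm
  -- Cauchy product: the coefficients of `A * A` dominate those of the geometric series.
  have hsq : (1 - s)⁻¹ ≤ A * A := by
    rw [hA, tsum_mul_tsum_eq_tsum_sum_range_of_summable_norm hn hn,
      ← tsum_geometric_of_lt_one hs0 hs1]
    refine Summable.tsum_le_tsum (fun n => ?_) (summable_geometric_of_lt_one hs0 hs1)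
      (summable_norm_sum_mul_range_of_summable_norm hn hn).of_norm
    have : ∑ k ∈ range (n + 1), p k * s ^ k * (p (n - k) * s ^ (n - k)) =
        (∑ k ∈ range (n + 1), p k * p (n - k)) * s ^ n := by
      rw [sum_mul]
      refine sum_congr rfl fun k hk => ?_
      have : k + (n - k) = n := by have := mem_range.1 hk; omega
      rw [← this, pow_add, this]; ring
    rw [this]
    exact le_mul_of_one_le_left (pow_nonneg hs0 n) (hconv n)
  have hs : 0 < 1 - s := by linarith
  -- Summation by parts with `p 0 = 1`; the value is `1 - (1 - s) * A`.
  refine ⟨s * A - (A - 1), ?_, ?_⟩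
  · have hle : √(1 - s) ≤ (1 - s) * A := by
      refine Real.sqrt_le_iff.2 ⟨by positivity, ?_⟩
      have := mul_le_mul_of_nonneg_left hsq (sq_nonneg (1 - s))
      have h2 : (1 - s) ^ 2 * (1 - s)⁻¹ = 1 - s := by field_simp
      rw [h2] at this
      calc 1 - s ≤ _ := this
        _ = _ := by ring
    linarith
  · have e1 : HasSum (fun n => s * (p n * s ^ n)) (s * A) := hsum.hasSum.mul_left s
    have e2 : HasSum (fun n => p (n + 1) * s ^ (n + 1)) (A - 1) := by
      have := (hasSum_nat_add_iff' (f := fun n => p n * s ^ n) 1).2 hsum.hasSum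
      simpa [hp0] using this
    have e3 : (fun n => s ^ (n + 1) * (p n - p (n + 1))) =
        fun n => s * (p n * s ^ n) - p (n + 1) * s ^ (n + 1) := by
      ext n; ring
    rw [e3]
    exact e1.sub e2

end SymmetricWalk

/-! ### Exponential change of measure. -/

section Tilting

/-- It suffices to compare boxes, where the integral of the product factors by independence of the
coordinates. -/
theorem pi_withDensity {ι α : Type*} [Fintype ι] [MeasurableSpace α] (μ : ι → Measure α)
    [∀ i, IsProbabilityMeasure (μ i)] {f : ι → α → ℝ≥0∞} (hf : ∀ i, Measurable (f i))
    [∀ i, SigmaFinite ((μ i).withDensity (f i))] :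
    Measure.pi (fun i => (μ i).withDensity (f i)) =
      (Measure.pi μ).withDensity fun x => ∏ i, f i (x i) := by
  refine Measure.pi_eq fun s hs => ?_
  rw [withDensity_apply _ (MeasurableSet.univ_pi hs),
    ← lintegral_indicator (MeasurableSet.univ_pi hs)]
  have hg : ∀ i, Measurable ((s i).indicator (f i)) := fun i => (hf i).indicator (hs i)
  have heq : (Set.univ.pi s).indicator (fun x : ι → α => ∏ i, f i (x i)) =
      fun x => ∏ i, (s i).indicator (f i) (x i) := by
    ext x
    by_cases hx : x ∈ Set.univ.pi s
    · rw [Set.indicator_of_mem hx]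
      exact Finset.prod_congr rfl fun i _ =>
        (Set.indicator_of_mem (hx i (Set.mem_univ i)) _).symm
    · rw [Set.indicator_of_notMem hx]
      simp only [Set.mem_univ_pi, not_forall] at hx
      obtain ⟨i, hi⟩ := hx
      exact (Finset.prod_eq_zero (Finset.mem_univ i) (Set.indicator_of_notMem hi _)).symm
  rw [heq, lintegral_prod_eq_prod_lintegral_of_indepFun Finset.univ
    (fun i (x : ι → α) => (s i).indicator (f i) (x i))
    (iIndepFun_pi fun i => (hg i).aemeasurable) fun i => (hg i).comp (measurable_pi_apply i)]
  refine Finset.prod_congr rfl fun i _ => ?_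
  rw [(measurePreserving_eval μ i).lintegral_comp (hg i), lintegral_indicator (hs i),
    withDensity_apply _ (hs i)]

theorem iidLaw_preimage_fin (ν : Measure ℝ) [IsProbabilityMeasure ν] (n : ℕ)
    {A : Set (Fin n → ℝ)} (hA : MeasurableSet A) :
    iidLaw ν {x | (fun i : Fin n => x i) ∈ A} = Measure.pi (fun _ : Fin n => ν) A := by
  rw [← Measure.infinitePi_eq_pi,
    ← Measure.map_infinitePi_infinitePi_of_inj (P := fun _ : ℕ => ν) (Fin.val_injective (n := n)),
    Measure.map_apply (by fun_prop) hA]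
  rfl

/-- Exponential change of measure: an event on which the walk ends below zero is less likely under
the law with density `c * exp (x / 2)` than `c ^ n` times its probability under `ν`. -/
theorem measure_le_pow_mul_iidLaw {Ω : Type*} [MeasurableSpace Ω] {P : Measure Ω}
    {X : ℕ → Ω → EReal} (hX : ∀ i, AEMeasurable (X i) P) (hindep : iIndepFun X P)
    {m : Measure EReal} (hm : ∀ i, P.map (X i) = m)
    {ν : Measure ℝ} [IsProbabilityMeasure ν] {c : ℝ≥0∞}
    (htilt : (m.restrict {⊥, ⊤}ᶜ).map EReal.toReal =
      ν.withDensity fun x => c * ENNReal.ofReal (Real.exp (x / 2)))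
    (n : ℕ) {B : Set (ℕ → ℝ)} (hB : MeasurableSet B)
    (hdep : ∀ x y : ℕ → ℝ, (∀ i < n, x i = y i) → x ∈ B → y ∈ B)
    (hneg : ∀ x ∈ B, ∑ i ∈ Finset.range n, x i ≤ 0) :
    P {ω | (∀ i < n, X i ω ≠ ⊥ ∧ X i ω ≠ ⊤) ∧ (fun i => (X i ω).toReal) ∈ B} ≤
      c ^ n * iidLaw ν B := by
  have hP := hindep.isProbabilityMeasure
  have hmP : IsProbabilityMeasure m := hm 0 ▸ Measure.isProbabilityMeasure_map (hX 0)
  have hfin : IsFiniteMeasure (ν.withDensity fun x => c * ENNReal.ofReal (Real.exp (x / 2))) := by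
    rw [← htilt]; infer_instance
  -- Padding by zeros; the padding value is immaterial because `B` depends only on the first `n`
  -- coordinates.
  let ext : (Fin n → ℝ) → ℕ → ℝ := fun x i => if h : i < n then x ⟨i, h⟩ else 0
  have hext : Measurable ext := by
    refine measurable_pi_lambda _ fun i => ?_
    simp only [ext]
    split_ifs <;> fun_prop
  have hres : ∀ (x : ℕ → ℝ), ∀ i < n, ext (fun i : Fin n => x i) i = x i :=
    fun x i hi => dif_pos hi
  have hext' : ∀ x : ℕ → ℝ, x ∈ B ↔ (fun i : Fin n => x i) ∈ ext ⁻¹' B := fun x =>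
    ⟨hdep _ _ fun i hi => (hres x i hi).symm, hdep _ _ (hres x)⟩
  have hlaw : P.map (fun ω (i : Fin n) => X i ω) = Measure.pi fun _ : Fin n => m := by
    have h := (iIndepFun_iff_map_fun_eq_pi_map (fun i : Fin n => hX i)).1
      (hindep.precomp Fin.val_injective)
    simpa only [hm] using h
  have hR : MeasurableSet ({⊥, ⊤}ᶜ : Set EReal) := (Set.toFinite _).measurableSet.compl
  have hBn : MeasurableSet (ext ⁻¹' B) := hext hB
  have htoReal : Measurable fun (z : Fin n → EReal) i => (z i).toReal :=
    measurable_pi_lambda _ fun i => measurable_ereal_toReal.comp (measurable_pi_apply i)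
  have hQ : iidLaw ν B = Measure.pi (fun _ : Fin n => ν) (ext ⁻¹' B) := by
    rw [← iidLaw_preimage_fin ν n hBn]
    congr 1
    ext x
    exact hext' x
  have hset : {ω | (∀ i < n, X i ω ≠ ⊥ ∧ X i ω ≠ ⊤) ∧ (fun i => (X i ω).toReal) ∈ B} =
      (fun ω (i : Fin n) => X i ω) ⁻¹' ((fun (z : Fin n → EReal) i => (z i).toReal) ⁻¹' (ext ⁻¹' B)
        ∩ Set.univ.pi fun _ => {⊥, ⊤}ᶜ) := by
    ext ω
    refine and_comm.trans (and_congr (hext' fun i => (X i ω).toReal) ?_)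
    simp [Fin.forall_iff]
  rw [hset, ← Measure.map_apply_of_aemeasurable (aemeasurable_pi_lambda _ fun i : Fin n => hX i)
    ((htoReal hBn).inter (MeasurableSet.univ_pi fun _ => hR)), hlaw,
    ← Measure.restrict_apply (htoReal hBn), Measure.restrict_pi_pi,
    ← Measure.map_apply htoReal hBn,
    Measure.pi_map_pi fun _ => measurable_ereal_toReal.aemeasurable]
  simp only [htilt]
  rw [pi_withDensity _ fun _ => by fun_prop, withDensity_apply _ hBn, hQ]
  -- The density is `c ^ n * exp (S_n / 2)`, and `S_n ≤ 0` on `B`.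
  calc _ ≤ ∫⁻ _ in ext ⁻¹' B, c ^ n ∂Measure.pi fun _ : Fin n => ν := by
        refine setLIntegral_mono measurable_const fun x hx => ?_
        rw [Finset.prod_mul_distrib, Finset.prod_const, Finset.card_univ, Fintype.card_fin,
          ← ENNReal.ofReal_prod_of_nonneg fun _ _ => (Real.exp_pos _).le, ← Real.exp_sum,
          ← Finset.sum_div]
        refine mul_le_of_le_one_right' ?_
        rw [ENNReal.ofReal_le_one, Real.exp_le_one_iff]
        have h := hneg _ hx
        rw [← Fin.sum_univ_eq_sum_range] at h
        simp only [ext, Fin.is_lt, dite_true, Fin.eta] at h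
        linarith
    _ = _ := by rw [setLIntegral_const]

end Tilting

/-! ### The log-likelihood ratio and its symmetrised law. -/

namespace BinaryInputChannel

variable {𝒴 : Type*} [MeasurableSpace 𝒴] (W : BinaryInputChannel 𝒴)

theorem measurable_llr : Measurable W.llr :=
  ENNReal.log_monotone.measurable.comp
    ((W.measurable_density .plus).coe_nnreal_ennreal.div
      (W.measurable_density .minus).coe_nnreal_ennreal)

theorem llr_eq_bot_iff (y : 𝒴) : W.llr y = ⊥ ↔ W.density .plus y = 0 := by
  simp [llr]

theorem llr_eq_top_iff (y : 𝒴) :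
    W.llr y = ⊤ ↔ W.density .plus y ≠ 0 ∧ W.density .minus y = 0 := by
  simp [llr, ENNReal.div_eq_top]

/-- The log-likelihood ratio as a real number. -/
noncomputable def realLLR (y : 𝒴) : ℝ :=
  Real.log (W.density .plus y) - Real.log (W.density .minus y)

theorem measurable_realLLR : Measurable W.realLLR :=
  (W.measurable_density .plus).coe_nnreal_real.log.sub
    (W.measurable_density .minus).coe_nnreal_real.log

theorem toReal_llr {y : 𝒴} (hp : W.density .plus y ≠ 0) (hq : W.density .minus y ≠ 0) :
    (W.llr y).toReal = W.realLLR y := by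
  rw [llr, realLLR, ← ENNReal.coe_div hq, ENNReal.log_of_nnreal (div_ne_zero hp hq),
    EReal.toReal_coe, NNReal.coe_div,
    Real.log_div (NNReal.coe_ne_zero.2 hp) (NNReal.coe_ne_zero.2 hq)]

theorem outputLaw_llr_eq_bot : W.outputLaw .plus {y | W.llr y = ⊥} = 0 := by
  have hm : MeasurableSet {y | W.llr y = ⊥} := W.measurable_llr (measurableSet_singleton ⊥)
  rw [outputLaw, withDensity_apply _ hm, setLIntegral_congr_fun (g := fun _ => 0) hm]
  · simp
  · intro y hy
    simpa using (W.llr_eq_bot_iff y).1 hy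

/-- The real log-likelihood ratio under the geometric mean of the two output densities. -/
noncomputable def geomLaw : Measure ℝ :=
  (W.refMeasure.withDensity fun y =>
    ENNReal.ofReal √((W.density .plus y : ℝ) * W.density .minus y)).map W.realLLR

theorem measurable_geomDensity : Measurable fun y =>
    ENNReal.ofReal √((W.density .plus y : ℝ) * W.density .minus y) :=
  (((W.measurable_density .plus).coe_nnreal_real.mul
    (W.measurable_density .minus).coe_nnreal_real).sqrt).ennreal_ofReal

theorem geomLaw_univ : W.geomLaw Set.univ = ENNReal.ofReal W.bhattacharyya := by
  rw [geomLaw, Measure.map_apply W.measurable_realLLR MeasurableSet.univ, Set.preimage_univ,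
    withDensity_apply _ MeasurableSet.univ, Measure.restrict_univ, bhattacharyya,
    ofReal_integral_eq_lintegral_ofReal W.integrable_sqrt_mul
      (Filter.Eventually.of_forall fun _ => Real.sqrt_nonneg _)]

variable {W} in
-- The involution exchanges the two densities, so it fixes their geometric mean and negates the
-- log-likelihood ratio.
theorem IsBMS.geomLaw_map_neg (hW : W.IsBMS) : W.geomLaw.map (fun x => -x) = W.geomLaw := by
  obtain ⟨σ, hσ, hmp, hden⟩ := hW
  have hden' : ∀ y, W.density .plus (σ y) = W.density .minus y := fun y => by rw [hden, hσ y]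
  have hL : ∀ y, W.realLLR (σ y) = -W.realLLR y := fun y => by
    rw [realLLR, realLLR, hden', ← hden]; ring
  ext A hA
  have hmL := W.measurable_realLLR
  rw [Measure.map_apply measurable_neg hA, geomLaw, Measure.map_apply hmL (measurable_neg hA),
    Measure.map_apply hmL hA, withDensity_apply _ (hmL (measurable_neg hA)),
    withDensity_apply _ (hmL hA), ← hmp.setLIntegral_comp_preimage (hmL hA)
      W.measurable_geomDensity]
  have hs : W.realLLR ⁻¹' ((fun x => -x) ⁻¹' A) = σ ⁻¹' (W.realLLR ⁻¹' A) := by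
    ext y; simp [hL]
  rw [hs]
  refine lintegral_congr fun y => ?_
  rw [hden', ← hden, mul_comm]

/-- Under `P_+`, the finite log-likelihood ratios have density `exp (x / 2)` with respect to
`geomLaw`. -/
theorem map_restrict_map_llr :
    (((W.outputLaw .plus).map W.llr).restrict {⊥, ⊤}ᶜ).map EReal.toReal =
      W.geomLaw.withDensity fun x => ENNReal.ofReal (Real.exp (x / 2)) := by
  have hmL := W.measurable_realLLR
  have hR : MeasurableSet ({⊥, ⊤}ᶜ : Set EReal) := (Set.toFinite _).measurableSet.compl
  ext A hA
  have hA' := measurable_ereal_toReal hA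
  rw [Measure.map_apply measurable_ereal_toReal hA, Measure.restrict_apply hA',
    Measure.map_apply W.measurable_llr (hA'.inter hR), outputLaw,
    withDensity_apply _ (W.measurable_llr (hA'.inter hR)), withDensity_apply _ hA, geomLaw,
    setLIntegral_map hA (by fun_prop) hmL,
    setLIntegral_withDensity_eq_setLIntegral_mul _ W.measurable_geomDensity
      (by fun_prop) (hmL hA),
    ← lintegral_indicator (W.measurable_llr (hA'.inter hR)), ← lintegral_indicator (hmL hA)]
  refine lintegral_congr fun y => ?_
  by_cases hpq : W.density .plus y ≠ 0 ∧ W.density .minus y ≠ 0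
  · obtain ⟨hp, hq⟩ := hpq
    have hiff : y ∈ W.llr ⁻¹' (EReal.toReal ⁻¹' A ∩ {⊥, ⊤}ᶜ) ↔ y ∈ W.realLLR ⁻¹' A := by
      simp [W.toReal_llr hp hq, llr_eq_bot_iff, llr_eq_top_iff, hp, hq]
    by_cases hy : y ∈ W.realLLR ⁻¹' A
    · rw [Set.indicator_of_mem hy, Set.indicator_of_mem (hiff.2 hy), Pi.mul_apply,
        ← ENNReal.ofReal_mul (Real.sqrt_nonneg _), ← ENNReal.ofReal_coe_nnreal]
      congr 1
      have hp' : (0 : ℝ) < W.density .plus y := NNReal.coe_pos.2 (pos_iff_ne_zero.2 hp)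
      have hq' : (0 : ℝ) < W.density .minus y := NNReal.coe_pos.2 (pos_iff_ne_zero.2 hq)
      -- With `p`, `q` the two densities, this is `√(p q) * √(p / q) = p`.
      rw [realLLR, ← Real.log_div hp'.ne' hq'.ne', ← Real.log_sqrt (by positivity),
        Real.exp_log (by positivity), ← Real.sqrt_mul (by positivity)]
      have : (W.density .plus y : ℝ) * W.density .minus y *
          (W.density .plus y / W.density .minus y) = (W.density .plus y : ℝ) ^ 2 := by
        field_simp
      rw [this, Real.sqrt_sq hp'.le]
    · rw [Set.indicator_of_notMem hy, Set.indicator_of_notMem (mt hiff.1 hy)]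
  -- Where a density vanishes, the ratio is infinite and excluded on the left, while the geometric
  -- mean is zero on the right; the default value of `realLLR` carries no mass.
  · have h0 : (W.density .plus y : ℝ) * W.density .minus y = 0 := by
      rw [not_and_or, not_not, not_not] at hpq
      rcases hpq with h | h <;> simp [h]
    rw [Set.indicator_of_notMem]
    · by_cases hy : y ∈ W.realLLR ⁻¹' A <;> simp only [hy, h0, Set.indicator_of_mem,
        Set.indicator_of_notMem, not_false_iff, Pi.mul_apply, Real.sqrt_zero, ENNReal.ofReal_zero,
        zero_mul]
    · simp only [Set.mem_preimage, Set.mem_inter_iff, Set.mem_compl_iff, Set.mem_insert_iff,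
        Set.mem_singleton_iff, llr_eq_bot_iff, llr_eq_top_iff]
      tauto

variable {W} in
/-- The exponential tilting that makes the log-likelihood ratio symmetric. -/
theorem IsBMS.exists_symmetric_tilting (hW : W.IsBMS) :
    ∃ ν : Measure ℝ, IsProbabilityMeasure ν ∧ ν.map (fun x => -x) = ν ∧
      (((W.outputLaw .plus).map W.llr).restrict {⊥, ⊤}ᶜ).map EReal.toReal =
        ν.withDensity fun x =>
          ENNReal.ofReal W.bhattacharyya * ENNReal.ofReal (Real.exp (x / 2)) := by
  have hmeas : Measurable fun x : ℝ => ENNReal.ofReal (Real.exp (x / 2)) := by fun_prop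
  rw [W.map_restrict_map_llr]
  by_cases hZ : ENNReal.ofReal W.bhattacharyya = 0
  -- `geomLaw` is then zero and cannot be normalised; any symmetric probability measure would do.
  · refine ⟨Measure.dirac 0, inferInstance, ?_, ?_⟩
    · rw [Measure.map_dirac' measurable_neg, neg_zero]
    · have h0 : W.geomLaw = 0 := by rw [← Measure.measure_univ_eq_zero, W.geomLaw_univ, hZ]
      simp [hZ, h0]
  · refine ⟨(ENNReal.ofReal W.bhattacharyya)⁻¹ • W.geomLaw, ⟨?_⟩, ?_, ?_⟩
    · rw [Measure.smul_apply, W.geomLaw_univ, smul_eq_mul,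
        ENNReal.inv_mul_cancel hZ ENNReal.ofReal_ne_top]
    · rw [Measure.map_smul, hW.geomLaw_map_neg]
    · rw [withDensity_smul_measure]
      change _ = _ • W.geomLaw.withDensity
        (ENNReal.ofReal W.bhattacharyya • fun x => ENNReal.ofReal (Real.exp (x / 2)))
      rw [withDensity_smul _ hmeas, smul_smul, ENNReal.inv_mul_cancel hZ ENNReal.ofReal_ne_top,
        one_smul]

end BinaryInputChannel

/-! ### Walks with increments in `EReal`. -/

section Walk

variable {Ω : Type*} {X : ℕ → Ω → EReal} {ω : Ω}

theorem walk_succ (x : ℝ) (n : ℕ) : walk X x (n + 1) ω = walk X x n ω + X n ω := by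
  rw [walk, walk, Finset.sum_range_succ, add_assoc]

theorem walk_ne_bot {x : ℝ} {n : ℕ} (h : ∀ i < n, X i ω ≠ ⊥) : walk X x n ω ≠ ⊥ := by
  induction n with
  | zero => simp [walk]
  | succ n ih =>
    rw [walk_succ, Ne, EReal.add_eq_bot_iff, not_or]
    exact ⟨ih fun i hi => h i (by omega), h n (by omega)⟩

/-- Without steps equal to `⊥`, the value `⊤` is absorbing. Thus a walk that is negative at time `n`
has taken only finite steps. -/
theorem ne_top_of_walk_ne_top {x : ℝ} {n : ℕ} (h : ∀ i < n, X i ω ≠ ⊥)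
    (hn : walk X x n ω ≠ ⊤) : ∀ i < n, X i ω ≠ ⊤ := by
  induction n with
  | zero => simp
  | succ n ih =>
    have hb : walk X x n ω ≠ ⊥ := walk_ne_bot fun i hi => h i (by omega)
    have h1 : X n ω ≠ ⊤ := fun ht => hn (by rw [walk_succ, ht, EReal.add_top_of_ne_bot hb])
    have h2 : walk X x n ω ≠ ⊤ := fun ht =>
      hn (by rw [walk_succ, ht, EReal.top_add_of_ne_bot (h n (by omega))])
    intro i hi
    rcases Nat.lt_succ_iff_lt_or_eq.1 hi with hi | rfl
    · exact ih (fun i hi => h i (by omega)) h2 i hi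
    · exact h1

theorem walk_eq_coe {x : ℝ} {n : ℕ} (h : ∀ i < n, X i ω ≠ ⊥ ∧ X i ω ≠ ⊤) :
    walk X x n ω = ((x + ∑ i ∈ Finset.range n, (X i ω).toReal : ℝ) : EReal) := by
  induction n with
  | zero => simp [walk]
  | succ n ih =>
    obtain ⟨h1, h2⟩ := h n (by omega)
    rw [walk_succ, ih fun i hi => h i (by omega), Finset.sum_range_succ, ← add_assoc,
      EReal.coe_add (_ + _), EReal.coe_toReal h2 h1]

theorem ruinTime_lt_top_iff (x : ℝ) : ruinTime X x ω < ⊤ ↔ ∃ n, walk X x (n + 1) ω < 0 := by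
  rw [ruinTime, sInf_lt_iff]
  constructor
  · rintro ⟨_, ⟨n, ⟨hn, h⟩, rfl⟩, _⟩
    exact ⟨n - 1, by rwa [Nat.sub_add_cancel hn]⟩
  · rintro ⟨n, h⟩
    exact ⟨_, ⟨n + 1, ⟨by omega, h⟩, rfl⟩, ENat.natCast_lt_top _⟩

/-- A walk that is ruined is, at its ruin time, negative for the first time. -/
theorem exists_mem_stayNonneg_of_ruinTime_lt_top (hb : ∀ i, X i ω ≠ ⊥)
    (h : ruinTime X 0 ω < ⊤) :
    ∃ n, (∀ i < n + 1, X i ω ≠ ⊥ ∧ X i ω ≠ ⊤) ∧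
      (fun i => (X i ω).toReal) ∈ stayNonneg n \ stayNonneg (n + 1) := by
  classical
  have hex := (ruinTime_lt_top_iff 0).1 h
  obtain ⟨n, hn⟩ : ∃ n, n = Nat.find hex := ⟨_, rfl⟩
  have hneg : walk X 0 (n + 1) ω < 0 := hn ▸ Nat.find_spec hex
  have hfin : ∀ i < n + 1, X i ω ≠ ⊥ ∧ X i ω ≠ ⊤ := fun i hi => ⟨hb i,
    ne_top_of_walk_ne_top (fun i _ => hb i) (hneg.trans EReal.zero_lt_top).ne i hi⟩
  refine ⟨n, hfin, fun j hj => ?_, fun hs => ?_⟩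
  · rcases j with _ | j
    · simp
    · have h1 : ¬walk X 0 (j + 1) ω < 0 := Nat.find_min hex (by omega)
      rw [walk_eq_coe fun i hi => hfin i (by omega), zero_add, not_lt] at h1
      exact_mod_cast h1
  · rw [walk_eq_coe hfin, zero_add] at hneg
    have h1 := hs (n + 1) le_rfl
    have h2 : ∑ i ∈ Finset.range (n + 1), (X i ω).toReal < 0 := by exact_mod_cast hneg
    linarith

end Walk

/-! ### The two bounds. -/

theorem tsum_one_div_mul_pow_le {z : ℝ} (h0 : 0 ≤ z) (h1 : z < 1) :
    ∑' n : ℕ, 1 / ((n + 1 : ℕ) : ℝ≥0∞) * (ENNReal.ofReal z ^ (n + 1) * 2⁻¹) =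
      ENNReal.ofReal (1 / 2 * -Real.log (1 - z)) := by
  have hs := (Real.hasSum_pow_div_log_of_abs_lt_one (abs_lt.2 ⟨by linarith, h1⟩)).mul_left (1 / 2)
  rw [← hs.tsum_eq, ENNReal.ofReal_tsum_of_nonneg (fun n => by positivity) hs.summable]
  refine tsum_congr fun n => ?_
  rw [← ENNReal.ofReal_pow h0, ENNReal.ofReal_mul (by norm_num), ENNReal.ofReal_div_of_pos
    (by positivity : (0 : ℝ) < n + 1), ENNReal.ofReal_div_of_pos (by norm_num)]
  have : ENNReal.ofReal ((n : ℝ) + 1) = ((n + 1 : ℕ) : ℝ≥0∞) := by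
    rw [← ENNReal.ofReal_natCast]; push_cast; rfl
  rw [this]
  simp [div_eq_mul_inv]
  ring

theorem mainTheorem5 {𝒴 : Type*} [MeasurableSpace 𝒴] (W : BinaryInputChannel 𝒴) (hW : W.IsBMS)
    {Ω : Type*} [MeasurableSpace Ω] (P : Measure Ω) [IsProbabilityMeasure P]
    (Y : ℕ → Ω → 𝒴) (hY : ∀ i, HasLaw (Y i) (W.outputLaw .plus) P)
    (Λ : ℕ → Ω → EReal) (hΛ : ∀ i ω, Λ i ω = W.llr (Y i ω)) (hindep : iIndepFun Λ P) :
    ((∑' n : ℕ, 1 / ((n + 1 : ℕ) : ℝ≥0∞) * P {ω | walk Λ 0 (n + 1) ω < 0} : ℝ≥0∞) : EReal) ≤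
        ((1 / 2 : ℝ) : EReal) * ENNReal.log (1 / ENNReal.ofReal (1 - W.bhattacharyya)) ∧
      ruinProbability P Λ 0 ≤ 1 - √(1 - W.bhattacharyya) ∧
      1 - √(1 - W.bhattacharyya) = W.ruinParameter := by
  obtain ⟨ν, hνP, hν, htilt⟩ := hW.exists_symmetric_tilting
  have hΛ' : ∀ i, Λ i = W.llr ∘ Y i := fun i => funext (hΛ i)
  have hmeas : ∀ i, AEMeasurable (Λ i) P := fun i => by
    rw [hΛ']; exact W.measurable_llr.comp_aemeasurable (hY i).aemeasurable
  have hlaw : ∀ i, P.map (Λ i) = (W.outputLaw .plus).map W.llr := fun i => by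
    rw [hΛ', ← AEMeasurable.map_map_of_aemeasurable W.measurable_llr.aemeasurable
      (hY i).aemeasurable, (hY i).map_eq]
  have hbot : ∀ᵐ ω ∂P, ∀ i, Λ i ω ≠ ⊥ := by
    refine ae_all_iff.2 fun i => ?_
    have h : P {ω | W.llr (Y i ω) = ⊥} = 0 := by
      rw [(hY i).measure_eq (p := fun y => W.llr y = ⊥)
        (W.measurable_llr (measurableSet_singleton ⊥)), W.outputLaw_llr_eq_bot]
    simpa [ae_iff, hΛ] using h
  have hZ0 := W.bhattacharyya_nonneg
  have hZ1 := W.bhattacharyya_le_one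
  set Z := W.bhattacharyya with hZ
  refine ⟨?_, ?_, rfl⟩
  · rcases hZ1.eq_or_lt with h1 | h1
    · rw [h1, sub_self, ENNReal.ofReal_zero, ENNReal.div_zero one_ne_zero, ENNReal.log_top,
        EReal.coe_mul_top_of_pos (by norm_num)]
      exact le_top
    have hle : ∀ n : ℕ, P {ω | walk Λ 0 (n + 1) ω < 0} ≤ ENNReal.ofReal Z ^ (n + 1) * 2⁻¹ := by
      intro n
      -- The power of `Z` comes from the change of measure, the factor 1/2 from symmetry.
      refine le_trans ?_ (mul_le_mul_right (iidLaw_sum_neg_le ν hν (n + 1)) _)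
      refine le_trans (measure_mono_ae ?_) (measure_le_pow_mul_iidLaw hmeas hindep hlaw htilt
        (n + 1) (measurableSet_lt (by fun_prop) measurable_const) ?_ fun x hx => le_of_lt hx)
      · filter_upwards [hbot] with ω hω hneg
        have hneg' : walk Λ 0 (n + 1) ω < 0 := hneg
        have hfin : ∀ i < n + 1, Λ i ω ≠ ⊥ ∧ Λ i ω ≠ ⊤ := fun i hi => ⟨hω i,
          ne_top_of_walk_ne_top (fun i _ => hω i) (hneg'.trans EReal.zero_lt_top).ne i hi⟩
        rw [walk_eq_coe hfin, zero_add] at hneg'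
        exact ⟨hfin, by exact_mod_cast hneg'⟩
      · intro x y hxy hx
        have : ∑ i ∈ Finset.range (n + 1), y i = ∑ i ∈ Finset.range (n + 1), x i :=
          Finset.sum_congr rfl fun i hi => (hxy i (Finset.mem_range.1 hi)).symm
        simpa [this] using hx
    have hsum : ∑' n : ℕ, 1 / ((n + 1 : ℕ) : ℝ≥0∞) * P {ω | walk Λ 0 (n + 1) ω < 0} ≤
        ENNReal.ofReal (1 / 2 * -Real.log (1 - Z)) := by
      rw [← tsum_one_div_mul_pow_le hZ0 h1]
      exact ENNReal.tsum_le_tsum fun n => mul_le_mul_right (hle n) _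
    have hlog : ENNReal.log (1 / ENNReal.ofReal (1 - Z)) = ((-Real.log (1 - Z) : ℝ) : EReal) := by
      rw [one_div, ENNReal.log_inv, ENNReal.log_ofReal_of_pos (by linarith), EReal.coe_neg]
    rw [hlog, ← EReal.coe_mul]
    refine (EReal.coe_ennreal_le_coe_ennreal_iff.2 hsum).trans (le_of_eq ?_)
    rw [EReal.coe_ennreal_ofReal, max_eq_left]
    have := Real.log_nonpos (by linarith : (0 : ℝ) ≤ 1 - Z) (by linarith)
    linarith
  · rcases hZ1.eq_or_lt with h1 | h1
    · rw [h1]; simp [ruinProbability]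
    obtain ⟨a, ha, hsum⟩ := hasSum_pow_mul_sub_le
      (p := fun n => (iidLaw ν).real (stayNonneg n)) (fun n => measureReal_nonneg)
      (fun n => measureReal_le_one) (by simp [stayNonneg_zero]) (one_le_sum_stayNonneg ν hν) hZ0 h1
    refine le_trans ?_ ha
    have hdiff : ∀ n, 0 ≤ (iidLaw ν).real (stayNonneg n) - (iidLaw ν).real (stayNonneg (n + 1)) :=
      fun n => sub_nonneg.2 (measureReal_mono (stayNonneg_succ_subset n))
    have hnn : ∀ n, 0 ≤ Z ^ (n + 1) *
        ((iidLaw ν).real (stayNonneg n) - (iidLaw ν).real (stayNonneg (n + 1))) :=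
      fun n => mul_nonneg (pow_nonneg hZ0 _) (hdiff n)
    refine ENNReal.toReal_le_of_le_ofReal (hsum.nonneg hnn) ?_
    rw [← hsum.tsum_eq, ENNReal.ofReal_tsum_of_nonneg hnn hsum.summable]
    calc P {ω | ruinTime Λ 0 ω < ⊤}
        ≤ P (⋃ n, {ω | (∀ i < n + 1, Λ i ω ≠ ⊥ ∧ Λ i ω ≠ ⊤) ∧
            (fun i => (Λ i ω).toReal) ∈ stayNonneg n \ stayNonneg (n + 1)}) := by
          refine measure_mono_ae ?_
          filter_upwards [hbot] with ω hω h
          exact Set.mem_iUnion.2 (exists_mem_stayNonneg_of_ruinTime_lt_top hω h)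
      _ ≤ _ := measure_iUnion_le _
      _ ≤ _ := ENNReal.tsum_le_tsum fun n => ?_
    refine (measure_le_pow_mul_iidLaw hmeas hindep hlaw htilt (n + 1)
      ((measurableSet_stayNonneg n).diff (measurableSet_stayNonneg (n + 1))) ?_ ?_).trans
      (le_of_eq ?_)
    · intro x y hxy hx
      have hS : ∀ j ≤ n + 1, ∑ i ∈ Finset.range j, y i = ∑ i ∈ Finset.range j, x i :=
        fun j hj => Finset.sum_congr rfl fun i hi =>
          (hxy i ((Finset.mem_range.1 hi).trans_le hj)).symm
      refine ⟨fun j hj => ?_, fun h => hx.2 fun j hj => ?_⟩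
      · rw [hS j (by omega)]; exact hx.1 j hj
      · rw [← hS j hj]; exact h j hj
    -- The first `n` sums are non-negative, so the failure at `n + 1` must come from the last sum.
    · intro x hx
      by_contra! hpos
      refine hx.2 fun j hj => ?_
      rcases Nat.le_succ_iff.1 hj with hj | rfl
      · exact hx.1 j hj
      · exact hpos.le
    · rw [ENNReal.ofReal_mul (pow_nonneg hZ0 _), ENNReal.ofReal_pow hZ0,
        ← measureReal_sdiff (stayNonneg_succ_subset n) (measurableSet_stayNonneg _),
        ofReal_measureReal]
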